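/- All structures are relational, and all operations have arity at least $1$. \textbf{Definitions.} A \emph{minion} is a set of functions $X^n\to Y$ ($n\ge 1$, with $X,Y$ fixed sets) that is closed under compositions of a single function with projections, i.e. under $f\mapsto\big((x_1,\dots,x_m)\mapsto f(x_{\sigma(1)},\dots,x_{\sigma(n)})\big)$ for $\sigma\colon[n]\to[m]$. A \emph{finite minor condition} $\mathcal E$ consists of finitely many function symbols and finitely many identities of the form $f(x_1,\dots,x_n)\approx g(y_1,\dots,y_m)$, where $f,g$ are among these symbols and the $x_i,y_j$ are variables. A minion $\mathcal M$ \emph{satisfies} $\mathcal E$, written $\mathcal M\models\mathcal E$, if the function symbols can be interpreted by members of $\mathcal M$ of the same arities so that all identities hold for all values of the variables (in particular, a condition with a symbol of arity $0$ is satisfied in no minion). Two minor conditions are \emph{equivalent with respect to satisfiability in minions} if every minion satisfies one if and only if it satisfies the other. Let $\mathbb A_1,\mathbb A_2$ be finite structures with the same finite signature $\tau$. For each $R\in\tau$ fix an enumeration $(x^R_{1,1},\dots,x^R_{k,1}),\dots,(x^R_{1,m},\dots,x^R_{k,m})$ of $R^{\mathbb A_1}$, where $k=\mathrm{ar}(R)$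 and $m=|R^{\mathbb A_1}|$. The minor condition $\mathcal E(\mathbb A_1,\mathbb A_2)$ has an $|R^{\mathbb A_1}|$-ary function symbol $g^R_{\mathbf t}$ for every $R\in\tau$ and every $\mathbf t\in R^{\mathbb A_2}$, the elements of $A_1$ as variables, and, for all $R,S\in\tau$, $\mathbf r\in R^{\mathbb A_2}$, $\mathbf s\in S^{\mathbb A_2}$ and indices $i,j$ with $\mathbf r_i=\mathbf s_j$, the identity $$g^R_{\mathbf r}(x^R_{i,1},\dots,x^R_{i,|R^{\mathbb A_1}|})\approx g^S_{\mathbf s}(x^S_{j,1},\dots,x^S_{j,|S^{\mathbb A_1}|}).$$ For structures $\mathbb A,\mathbb C$ of the same signature, $\mathbb A\to\mathbb C$ means that there is a homomorphism from $\mathbb A$ to $\mathbb C$. $\mathrm{Pol}(\mathbb B)$ is the set of all polymorphisms of $\mathbb B$. A \emph{primitive positive} (pp) formula is one of the form $\exists x_1,\dots,x_m(\phi_1\wedge\dots\wedge\phi_n)$, where each $\phi_i$ is $\bot$, an equality, or $R(x_{i_1},\dots,x_{i_\ell})$ for a relation symbol $R$. A \emph{pp-power} of $\mathbb B$ is a structure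 $\mathbb C$ with domain $B^d$ for some $d\ge 1$ such that every relation $R^{\mathbb C}\subseteq(B^d)^n$ of $\mathbb C$, regarded as a subset of $B^{nd}$, has a pp-definition in $\mathbb B$. A countable (finite or countably infinite) structure $\mathbb B$ is \emph{$\omega$-categorical} if its first-order theory has exactly one countable model up to isomorphism. \textbf{Theorem.} For every finite minor condition $\mathcal E$ there exist a finite relational signature $\tau$ and finite $\tau$-structures $\mathbb A_1,\mathbb A_2$ such that $\mathcal E$ and $\mathcal E(\mathbb A_1,\mathbb A_2)$ are equivalent with respect to satisfiability in minions. Moreover, for every finite relational signature $\tau$, all finite $\tau$-structures $\mathbb A_1,\mathbb A_2$ for which $\mathcal E$ and $\mathcal E(\mathbb A_1,\mathbb A_2)$ are equivalent in this sense, and every non-empty countable $\omega$-categorical structure $\mathbb B$ with countable relational signature, the following are equivalent: \begin{enumerate} \item $\mathrm{Pol}(\mathbb B)\models\mathcal E$; \item for every pp-power $\mathbb C$ of $\mathbb B$ with signature $\tau$, if $\mathbb A_1\to\mathbb C$, then $\mathbb A_2\to\mathbb C$. \end{enumerate} -/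

import Mathlib

open scoped FirstOrder

universe u v w u₁ v₁ w₁ w₂ x y

/-- A minion on a pair of sets `(X, Y)`: a set of functions `X ^ n → Y` of arities `n ≥ 1` that is
closed under composing a single function with projections, i.e. under
`f ↦ ((x₁, …, xₘ) ↦ f (x_{σ 1}, …, x_{σ n}))`. -/
structure Minion (X : Type u) (Y : Type v) where
  /-- The `n`-ary members. -/
  ops : (n : ℕ) → Set ((Fin n → X) → Y)
  arity_pos : ∀ {n : ℕ} {f : (Fin n → X) → Y}, f ∈ ops n → 0 < n
  minor_mem : ∀ {n m : ℕ} {f : (Fin n → X) → Y}, f ∈ ops n →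
    ∀ σ : Fin n → Fin m, (fun a : Fin m → X => f (fun i => a (σ i))) ∈ ops m

/-- A minor condition: function symbols with arities, names of variables, and a set of identities
`f (x₁, …, xₙ) ≈ g (y₁, …, yₘ)` between terms consisting of one symbol applied to variables.
A chain `t₁ ≈ ⋯ ≈ tₖ` is the set of its identities `tᵢ ≈ tᵢ₊₁`. -/
structure MinorCondition where
  Symbol : Type u
  arity : Symbol → ℕ
  Var : Type v
  identities : Set ((Σ f : Symbol, (Fin (arity f) → Var)) × (Σ f : Symbol, (Fin (arity f) → Var)))

namespace MinorCondition

/-- Finitely many function symbols and finitely many identities. -/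
def IsFinite (E : MinorCondition.{u, v}) : Prop :=
  Finite E.Symbol ∧ E.identities.Finite

/-- The minion `M` satisfies `E`: the symbols of `E` can be interpreted by members of `M` of the
same arity such that every identity holds for all values of the variables. -/
def SatisfiedIn (E : MinorCondition.{u, v}) {X : Type w} {Y : Type x} (M : Minion X Y) : Prop :=
  ∃ I : (f : E.Symbol) → (Fin (E.arity f) → X) → Y,
    (∀ f, I f ∈ M.ops (E.arity f)) ∧
    ∀ p ∈ E.identities, ∀ a : E.Var → X,
      I p.1.1 (fun i => a (p.1.2 i)) = I p.2.1 (fun i => a (p.2.2 i))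

/-- Two minor conditions are equivalent with respect to satisfiability in minions. -/
def Equivalent (E : MinorCondition.{u, v}) (E' : MinorCondition.{u₁, v₁}) : Prop :=
  ∀ (X Y : Type w) (M : Minion X Y), E.SatisfiedIn M ↔ E'.SatisfiedIn M

end MinorCondition

/-- The relation symbols of a language, of all arities. -/
abbrev RelSymbol (τ : FirstOrder.Language.{u, v}) : Type v := Σ n : ℕ, τ.Relations n

/-- The relation `R^A`, as the type of its tuples. -/
abbrev RelTuple {τ : FirstOrder.Language.{u, v}} (A : Type w) [τ.Structure A] (R : RelSymbol τ) :
    Type w :=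
  {t : Fin R.1 → A // FirstOrder.Language.Structure.RelMap R.2 t}

/-- A fixed enumeration of the tuples of `R^A`. -/
noncomputable def enumTuples {τ : FirstOrder.Language.{u, v}} (A : Type w) [τ.Structure A] [Finite A]
    (R : RelSymbol τ) : Fin (Nat.card (RelTuple A R)) ≃ RelTuple A R :=
  (Finite.equivFin (RelTuple A R)).symm

/-- The minor condition `E(A₁, A₂)`. There is one symbol `g^R_t` of arity `|R^{A₁}|` for every
relation symbol `R` and every `t ∈ R^{A₂}`; the variables are the elements of `A₁`. Whenever
`r ∈ R^{A₂}`, `s ∈ S^{A₂}` and `r i = s j`, it contains the identity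
`g^R_r (i-th entries of the tuples of R^{A₁}) ≈ g^S_s (j-th entries of the tuples of S^{A₁})`. -/
noncomputable def minorConditionOf (τ : FirstOrder.Language.{u, v}) (A₁ : Type w₁) (A₂ : Type w₂)
    [τ.Structure A₁] [τ.Structure A₂] [Finite A₁] : MinorCondition.{max v w₂, w₁} where
  Symbol := Σ R : RelSymbol τ, RelTuple A₂ R
  arity g := Nat.card (RelTuple A₁ g.1)
  Var := A₁
  identities := {p | ∃ (R S : RelSymbol τ) (r : RelTuple A₂ R) (s : RelTuple A₂ S)
    (i : Fin R.1) (j : Fin S.1), r.1 i = s.1 j ∧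
      p = (⟨⟨R, r⟩, fun l => (enumTuples A₁ R l).1 i⟩, ⟨⟨S, s⟩, fun l => (enumTuples A₁ S l).1 j⟩)}

/-- The polymorphisms of a relational structure `B` (of arities `n ≥ 1`), with the fact that they
form a minion. -/
def Pol (L : FirstOrder.Language.{u, v}) (B : Type w) [L.Structure B] : Minion B B where
  ops n := {f | 0 < n ∧ ∀ (k : ℕ) (R : L.Relations k) (t : Fin n → Fin k → B),
    (∀ j, FirstOrder.Language.Structure.RelMap R (t j)) →
      FirstOrder.Language.Structure.RelMap R (fun i => f (fun j => t j i))}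
  arity_pos h := h.1
  minor_mem := by
    rintro n m f ⟨hn, hf⟩ σ
    exact ⟨(σ ⟨0, hn⟩).pos, fun k R t ht => hf k R (fun j => t (σ j)) (fun j => ht (σ j))⟩

/-- A primitive positive formula `∃ x₁ … xₘ (φ₁ ∧ ⋯ ∧ φₙ)` with free variables from `α`, where
every `φᵢ` is `⊥` or an atomic formula (an equality or a relation symbol applied to variables,
when the language is relational). -/
structure PPFormula (L : FirstOrder.Language.{u, v}) (α : Type x) where
  numBound : ℕ
  conjuncts : List (L.Formula (α ⊕ Fin numBound))
  atomic : ∀ φ ∈ conjuncts, φ = ⊥ ∨ FirstOrder.Language.BoundedFormula.IsAtomic φ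

/-- Truth of a primitive positive formula under an assignment of its free variables. -/
def PPFormula.Realize {L : FirstOrder.Language.{u, v}} {α : Type x} {B : Type w} [L.Structure B]
    (φ : PPFormula L α) (a : α → B) : Prop :=
  ∃ b : Fin φ.numBound → B, ∀ ψ ∈ φ.conjuncts, FirstOrder.Language.Formula.Realize ψ (Sum.elim a b)

/-- The relation `S` has a primitive positive definition (without parameters) in `B`. -/
def PPDefinable (L : FirstOrder.Language.{u, v}) {α : Type x} {B : Type w} [L.Structure B]
    (S : Set (α → B)) : Prop :=
  ∃ φ : PPFormula L α, S = {a | φ.Realize a}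

/-- A pp-power with signature `τ` of the structure `B`: a `τ`-structure on `B ^ d` with `d ≥ 1`,
such that every relation of arity `n`, seen as a relation of arity `n * d` over `B`, has a
primitive positive definition in `B`. -/
structure PPPower (τ : FirstOrder.Language.{u₁, v₁}) (L : FirstOrder.Language.{u, v}) (B : Type w) [L.Structure B] where
  dim : ℕ
  one_le_dim : 1 ≤ dim
  str : τ.Structure (Fin dim → B)
  ppDefinable : ∀ (n : ℕ) (R : τ.Relations n),
    PPDefinable L {a : Fin n × Fin dim → B | str.RelMap R (fun i j => a (i, j))}

/-- The domain `B ^ d` of a pp-power. -/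
def PPPower.Carrier {τ : FirstOrder.Language.{u₁, v₁}} {L : FirstOrder.Language.{u, v}} {B : Type w} [L.Structure B]
    (C : PPPower τ L B) : Type w :=
  Fin C.dim → B

instance PPPower.instStructureCarrier {τ : FirstOrder.Language.{u₁, v₁}} {L : FirstOrder.Language.{u, v}} {B : Type w} [L.Structure B]
    (C : PPPower τ L B) : τ.Structure C.Carrier :=
  C.str

/-- `A → B`: there is a homomorphism from `A` to `B`. -/
def HomTo (τ : FirstOrder.Language.{u, v}) (A : Type w₁) (B : Type w₂) [τ.Structure A] [τ.Structure B] :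
    Prop :=
  Nonempty (A →[τ] B)

/-- `B` is `ω`-categorical: all countably infinite models of its first-order theory are isomorphic.
For an infinite countable `B` this says that the theory has exactly one countable model;
a finite `B` is the only model of its theory and satisfies the condition. -/
def OmegaCategorical (L : FirstOrder.Language.{u, v}) (B : Type w) [L.Structure B] : Prop :=
  Cardinal.Categorical (Cardinal.aleph0 : Cardinal.{w}) (L.completeTheory B)

/-!
The first assertion holds because a finite minor condition can be encoded directly in a pair of
structures. Take one relation symbol per function symbol `f`. In `A₂` its relation is a single
tuple, and in `A₁` it has one tuple for each argument of `f`, so that `E(A₁, A₂)` again has one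
symbol of the arity of `f`. Each side of each identity is given a coordinate: there the tuples of
`A₁` list the variables of the term, and the two tuples of `A₂` have a common entry. Hence the
identities of `E(A₁, A₂)` are those of `E`, together with trivial ones
(`MinorCondition.Presentation.satisfiedIn_minorConditionOf` and its converse
`MinorCondition.Presentation.satisfiedIn_of_minorConditionOf`).

For the second assertion it suffices to treat `E(A₁, A₂)` itself. If `Pol(B)` satisfies it, the
interpretations of its symbols turn a homomorphism `A₁ → C` into a homomorphism `A₂ → C`, since
polymorphisms preserve pp-definable relations (`homTo_of_satisfiedIn_pol`).

Conversely, regard the values of the required operations as unknowns in `B`. The requirements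
that they be polymorphisms and satisfy the identities are atomic formulas in countably many
variables. A finite subset of them involves only finitely many assignments `F c : A₁ → B` and
finitely many instances of preservation; the tuples obtained from those of `R^{A₁}` by operations
satisfying these instances form a pp-definable relation on a power of `B` (`approxRel`). Projections
show that `A₁` maps to the resulting pp-power, and a homomorphism from `A₂` to it provides a
solution of the finite subset (`satisfiedIn_pol_of_homTo`). So the whole set is finitely
satisfiable. It is then satisfiable in a countable model of the theory of `B` by compactness and
the Löwenheim–Skolem theorem, and this model is isomorphic to `B` when `B` is infinite
(`OmegaCategorical.exists_realize`); for finite `B` an ultrafilter argument is enough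
(`exists_realize_of_finite`). In this way `ω`-categoricity is used only through its definition, and
a description of all relations invariant under `Pol(B)` is not needed.
-/

/-! ### Formulas depend on finitely many variables; compactness -/

section ModelTheory

open FirstOrder Language

variable {L : FirstOrder.Language.{u, v}} {B : Type w} [L.Structure B]

theorem FirstOrder.Language.Formula.realize_congr {α : Type x} [DecidableEq α] (φ : L.Formula α)
    {a a' : α → B} (h : ∀ i ∈ φ.freeVarFinset, a i = a' i) : φ.Realize a ↔ φ.Realize a' :=
  (BoundedFormula.realize_restrictFreeVar (f := id) (v := fun i => a i) a fun _ => rfl).symm.trans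
    (BoundedFormula.realize_restrictFreeVar (f := id) (v := fun i => a i) a' fun i => h i i.2)

/-- Over a finite structure, finitely satisfiable sets of formulas are satisfiable: the value of a
variable is its value along an ultrafilter of solutions of the finite subsets. -/
theorem exists_realize_of_finite [Finite B] {V : Type x} {ι : Type y} (Γ : ι → L.Formula V)
    (h : ∀ s : Finset ι, ∃ a : V → B, ∀ i ∈ s, (Γ i).Realize a) :
    ∃ a : V → B, ∀ i, (Γ i).Realize a := by
  classical
  choose a ha using h
  let U : Ultrafilter (Finset ι) := Ultrafilter.of Filter.atTop
  have hlim (v : V) : ∃ b : B, ∀ᶠ s in (U : Filter (Finset ι)), a s v = b := by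
    obtain ⟨b, hb⟩ := (Ultrafilter.eventually_exists_iff (f := U)
      (P := fun (b : B) s => a s v = b)).1 (Filter.Eventually.of_forall fun s => ⟨_, rfl⟩)
    exact ⟨b, hb⟩
  choose b hb using hlim
  refine ⟨b, fun i => ?_⟩
  have h₁ : ∀ᶠ s in (U : Filter (Finset ι)), ∀ v ∈ (Γ i).freeVarFinset, a s v = b v :=
    (Filter.eventually_all_finset _).2 fun v _ => hb v
  have h₂ : ∀ᶠ s in (U : Filter (Finset ι)), i ∈ s :=
    Ultrafilter.of_le _ ((Filter.eventually_ge_atTop {i}).mono fun s hs => by simpa using hs)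
  obtain ⟨s, hs₁, hs₂⟩ := (h₁.and h₂).exists
  exact ((Γ i).realize_congr hs₁).1 (ha s i hs₂)

/-- Over an `ω`-categorical structure, a finitely satisfiable set of formulas in countably many
variables is satisfiable: by compactness and the Löwenheim–Skolem theorem it is satisfied in some
countable model of the theory, and this model is isomorphic to the structure. -/
theorem OmegaCategorical.exists_realize [Nonempty B] [Countable B] [Countable L.Symbols]
    (hB : OmegaCategorical L B) {V : Type x} [Countable V] {ι : Type y} (Γ : ι → L.Formula V)
    (h : ∀ s : Finset ι, ∃ a : V → B, ∀ i ∈ s, (Γ i).Realize a) :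
    ∃ a : V → B, ∀ i, (Γ i).Realize a := by
  classical
  cases finite_or_infinite B
  · exact exists_realize_of_finite Γ h
  let T₀ : L[[V]].Theory := (L.lhomWithConstants V).onTheory (L.completeTheory B)
  let T (s : Finset ι) : L[[V]].Theory := T₀ ∪ (fun i => Formula.equivSentence (Γ i)) '' s
  have hmono : Monotone T := fun s t hst => Set.union_subset_union_right _ (Set.image_mono hst)
  have hsat : Theory.IsSatisfiable (⋃ s, T s) := by
    refine (Theory.isSatisfiable_directed_union_iff hmono.directed_le).2 fun s => ?_
    obtain ⟨a, ha⟩ := h s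
    let := constantsOn.structure a
    have h₀ : B ⊨ T₀ := (LHom.onTheory_model _ _).2 inferInstance
    have : B ⊨ T s := by
      refine Theory.model_union_iff.2 ⟨h₀, (Theory.model_iff _).2 ?_⟩
      rintro _ ⟨i, hi, rfl⟩
      exact (Formula.realize_equivSentence B (Γ i)).2 (ha i hi)
    exact Theory.Model.isSatisfiable B
  have hinf : ∀ M : Theory.ModelType.{max u x, v, max u x v} (⋃ s, T s), Infinite M := by
    intro M
    let := (L.lhomWithConstants V).reduct M
    have : M ⊨ T₀ := Theory.Model.mono M.is_model
      (Set.subset_union_left.trans (Set.subset_iUnion T ∅))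
    have : M ⊨ L.completeTheory B := (LHom.onTheory_model (L.lhomWithConstants V) _).1 this
    exact (ElementarilyEquivalent.infinite_iff (L := L) (M := B) (N := M)
      (elementarilyEquivalent_iff.2 fun φ =>
        (realize_iff_of_model_completeTheory B M φ).symm)).1 inferInstance
  have hL : L.card ≤ Cardinal.aleph0 := Cardinal.mk_le_aleph0_iff.2 inferInstance
  have hcard : L[[V]].card ≤ Cardinal.aleph0 := by
    rw [card_withConstants]
    exact Cardinal.add_le_aleph0.2 ⟨by simpa using hL, by simp⟩
  obtain ⟨N, hN⟩ := Theory.exists_model_card_eq.{max u x, v, w} ⟨hsat.some, hinf _⟩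
    Cardinal.aleph0 le_rfl (by simpa using hcard)
  let := (L.lhomWithConstants V).reduct N
  have hN₀ : N ⊨ T₀ := Theory.Model.mono N.is_model
    (Set.subset_union_left.trans (Set.subset_iUnion T ∅))
  have : N ⊨ L.completeTheory B := (LHom.onTheory_model (L.lhomWithConstants V) _).1 hN₀
  obtain ⟨e⟩ := hB (Theory.ModelType.of _ N) (Theory.ModelType.of _ B) hN (Cardinal.mk_eq_aleph0 B)
  change N ≃[L] B at e
  refine ⟨fun v => e (L.con v : N), fun i => ?_⟩
  have : (Formula.equivSentence (Γ i)).Realize N := N.is_model.realize_of_mem _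
    (Set.mem_iUnion.2 ⟨{i}, Or.inr ⟨i, by simp, rfl⟩⟩)
  exact (StrongHomClass.realize_formula e (Γ i)).2 ((Formula.realize_equivSentence N _).1 this)

end ModelTheory

/-! ### Primitive positive definitions -/

section PrimitivePositive

open FirstOrder Language

variable {L : FirstOrder.Language.{u, v}} {B : Type w} [L.Structure B]

/-- An existentially quantified finite conjunction defines a primitive positive relation even when
the quantified variables form an infinite set, as only finitely many of them occur. -/
theorem ppDefinable_of_finite [Nonempty B] {α : Type x} {β : Type y}
    {Δ : Set (L.Formula (α ⊕ β))} (hΔ : Δ.Finite)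
    (hat : ∀ ψ ∈ Δ, ψ = ⊥ ∨ BoundedFormula.IsAtomic ψ) :
    PPDefinable L {a : α → B | ∃ b : β → B, ∀ ψ ∈ Δ, ψ.Realize (Sum.elim a b)} := by
  classical
  let T : Finset β := hΔ.toFinset.biUnion fun ψ => ψ.freeVarFinset.toRight
  -- the last bound variable stands for all variables that do not occur
  let r (b : β) : Fin (T.card + 1) :=
    if hb : b ∈ T then (T.equivFin ⟨b, hb⟩).castSucc else Fin.last _
  refine ⟨⟨T.card + 1, hΔ.toFinset.toList.map (Formula.relabel (Sum.map id r)), ?_⟩, ?_⟩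
  · intro φ hφ
    obtain ⟨ψ, hψ, rfl⟩ := List.mem_map.1 hφ
    rcases hat ψ (by simpa using hψ) with rfl | h
    · exact Or.inl rfl
    · exact Or.inr (h.relabel _)
  · ext a
    simp only [PPFormula.Realize, Set.mem_ofPred_eq, List.forall_mem_map, Finset.mem_toList,
      Set.Finite.mem_toFinset, Formula.realize_relabel]
    constructor
    · rintro ⟨b, hb⟩
      refine ⟨Fin.lastCases (Classical.arbitrary B) fun i => b (T.equivFin.symm i),
        fun ψ hψ => (ψ.realize_congr ?_).1 (hb ψ hψ)⟩
      rintro (i | i) hi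
      · rfl
      · have hiT : i ∈ T := Finset.mem_biUnion.2 ⟨ψ, by simpa using hψ, by simpa using hi⟩
        simp [r, hiT]
    · rintro ⟨b, hb⟩
      refine ⟨b ∘ r, fun ψ hψ => ?_⟩
      have := hb ψ hψ
      rwa [Sum.elim_comp_map] at this

variable [L.IsRelational]

theorem realize_atomic_of_mem_pol {α : Type x} {n : ℕ} {f : (Fin n → B) → B}
    (hf : f ∈ (Pol L B).ops n) {ψ : L.Formula α} (hψ : ψ = ⊥ ∨ BoundedFormula.IsAtomic ψ)
    {a : Fin n → α → B} (ha : ∀ j, ψ.Realize (a j)) : ψ.Realize fun i => f fun j => a j i := by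
  have hterm (t : L.Term (α ⊕ Fin 0)) :
      t.realize (Sum.elim (fun i => f fun j => a j i) (default : Fin 0 → B)) =
        f fun j => t.realize (Sum.elim (a j) (default : Fin 0 → B)) := by
    rcases t with (i | i) | g
    · rfl
    · exact i.elim0
    · exact isEmptyElim g
  rcases hψ with rfl | h
  · exact (ha ⟨0, hf.1⟩).elim
  · cases h with
    | equal t₁ t₂ =>
      refine (hterm t₁).trans ((congrArg f (funext fun j => ?_)).trans (hterm t₂).symm)
      exact ha j
    | rel R ts =>
      have := hf.2 _ R (fun j i => (ts i).realize (Sum.elim (a j) (default : Fin 0 → B))) ha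
      simp only [← hterm] at this
      exact this

/-- Polymorphisms preserve primitive positive definable relations. -/
theorem PPDefinable.mem_of_mem_pol {α : Type x} {S : Set (α → B)} (hS : PPDefinable L S) {n : ℕ}
    {f : (Fin n → B) → B} (hf : f ∈ (Pol L B).ops n) {a : Fin n → α → B} (ha : ∀ j, a j ∈ S) :
    (fun i => f fun j => a j i) ∈ S := by
  obtain ⟨φ, rfl⟩ := hS
  choose b hb using ha
  refine ⟨fun i => f fun j => b j i, fun ψ hψ => ?_⟩
  convert realize_atomic_of_mem_pol hf (φ.atomic ψ hψ) (fun j => hb j ψ hψ) using 1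
  ext (i | i) <;> rfl

end PrimitivePositive

/-! ### The condition `E(A₁, A₂)` in polymorphism minions -/

section PolymorphismMinion

open FirstOrder Language Structure

variable {τ : FirstOrder.Language.{u₁, v₁}}
  {A₁ : Type w₁} {A₂ : Type w₂} [τ.Structure A₁] [τ.Structure A₂] [Finite A₁]
  {L : FirstOrder.Language.{u, v}} {B : Type w} [L.Structure B]

/-- Applying the interpretations of the symbols to a homomorphism `A₁ → C` gives a homomorphism
`A₂ → C`: the identities make it well defined, and polymorphisms preserve the relations of `C`. -/
theorem homTo_of_satisfiedIn_pol [τ.IsRelational] [L.IsRelational] [Nonempty B]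
    (h : (minorConditionOf τ A₁ A₂).SatisfiedIn (Pol L B)) (C : PPPower τ L B)
    (hC : HomTo τ A₁ C.Carrier) : HomTo τ A₂ C.Carrier := by
  classical
  obtain ⟨I, hI, hid⟩ := h
  obtain ⟨e⟩ := hC
  let value (R : RelSymbol τ) (t : RelTuple A₂ R) (i : Fin R.1) : C.Carrier :=
    fun c => I ⟨R, t⟩ fun l => e ((enumTuples A₁ R l).1 i) c
  have hvalue (R S : RelSymbol τ) (r : RelTuple A₂ R) (s : RelTuple A₂ S) (i : Fin R.1)
      (j : Fin S.1) (hij : r.1 i = s.1 j) : value R r i = value S s j :=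
    funext fun c => hid _ ⟨R, S, r, s, i, j, hij, rfl⟩ fun z => e z c
  let occurs (z : A₂) (p : Σ (R : RelSymbol τ) (_ : RelTuple A₂ R), Fin R.1) : Prop :=
    p.2.1.1 p.2.2 = z
  let k (z : A₂) : C.Carrier :=
    if hz : ∃ p, occurs z p then value hz.choose.1 hz.choose.2.1 hz.choose.2.2
    else fun _ => Classical.arbitrary B
  have hk (R : RelSymbol τ) (t : RelTuple A₂ R) (i : Fin R.1) : k (t.1 i) = value R t i := by
    have hz : ∃ p, occurs (t.1 i) p := ⟨⟨R, t, i⟩, rfl⟩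
    exact (dif_pos hz).trans (hvalue _ _ _ _ _ _ hz.choose_spec)
  refine ⟨⟨k, fun f => isEmptyElim f, fun {n} R t ht => ?_⟩⟩
  have hkt : k ∘ t = fun i => value ⟨n, R⟩ ⟨t, ht⟩ i := funext fun i => hk ⟨n, R⟩ ⟨t, ht⟩ i
  rw [hkt]
  exact (C.ppDefinable n R).mem_of_mem_pol (hI ⟨⟨n, R⟩, ⟨t, ht⟩⟩)
    (a := fun l p => e ((enumTuples A₁ ⟨n, R⟩ l).1 p.1) p.2)
    fun l => e.map_rel R _ (enumTuples A₁ ⟨n, R⟩ l).2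

/-- The instances of the condition that an `m`-ary operation on `B` is a polymorphism: a relation
symbol `S` together with `m` tuples of the relation `S^B`. -/
abbrev PreservationInstance (L : FirstOrder.Language.{u, v}) (B : Type w) [L.Structure B] (m : ℕ) :
    Type (max v w) :=
  {q : Σ S : RelSymbol L, (Fin m → Fin S.1 → B) // ∀ j, RelMap q.1.2 (q.2 j)}

/-- The formula expressing one instance of preservation, when the value of an operation at the
argument `b` is denoted by the variable `var b`. -/
def PreservationInstance.formula {m : ℕ} (q : PreservationInstance L B m) {β : Type x}
    (var : (Fin m → B) → β) : L.Formula β :=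
  q.1.1.2.formula fun i => Term.var (var fun j => q.1.2 j i)

theorem PreservationInstance.realize_formula {m : ℕ} (q : PreservationInstance L B m) {β : Type x}
    (var : (Fin m → B) → β) (b : β → B) :
    (q.formula var).Realize b ↔ RelMap q.1.1.2 fun i => b (var fun j => q.1.2 j i) := by
  simp [formula]

/-- The relation of the pp-power associated with finitely many assignments `F c : A₁ → B` and a
finite set of instances of preservation: a tuple is related if it is obtained from the tuples of
`R^{A₁}`, evaluated under every `F c`, by an operation that satisfies these instances. -/
def approxRel {d : ℕ} (F : Fin d → A₁ → B) (R : RelSymbol τ)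
    (Δ : Set (PreservationInstance L B (Nat.card (RelTuple A₁ R)))) (t : Fin R.1 → Fin d → B) :
    Prop :=
  0 < Nat.card (RelTuple A₁ R) ∧ ∃ f : (Fin (Nat.card (RelTuple A₁ R)) → B) → B,
    (∀ q ∈ Δ, RelMap q.1.1.2 fun i => f fun j => q.1.2 j i) ∧
    ∀ i c, t i c = f fun l => F c ((enumTuples A₁ R l).1 i)

theorem ppDefinable_approxRel [Nonempty B] {d : ℕ} (F : Fin d → A₁ → B) (R : RelSymbol τ)
    {Δ : Set (PreservationInstance L B (Nat.card (RelTuple A₁ R)))} (hΔ : Δ.Finite) :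
    PPDefinable L {a : Fin R.1 × Fin d → B | approxRel F R Δ fun i c => a (i, c)} := by
  -- the bound variables are the values of the operation; `⊥` is a conjunct if its arity is zero
  let Ψ : Set (L.Formula ((Fin R.1 × Fin d) ⊕ (Fin (Nat.card (RelTuple A₁ R)) → B))) :=
    {ψ | ψ = ⊥ ∧ Nat.card (RelTuple A₁ R) = 0} ∪ ((fun q => q.formula Sum.inr) '' Δ ∪
      Set.range fun p : Fin R.1 × Fin d => Term.equal (Term.var (Sum.inl p))
        (Term.var (Sum.inr fun l => F p.2 ((enumTuples A₁ R l).1 p.1))))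
  have hΨ : Ψ.Finite := ((Set.finite_singleton ⊥).subset fun ψ hψ => hψ.1).union
    ((hΔ.image _).union (Set.finite_range _))
  have hat : ∀ ψ ∈ Ψ, ψ = ⊥ ∨ BoundedFormula.IsAtomic ψ := by
    rintro ψ (⟨h, -⟩ | ⟨q, -, rfl⟩ | ⟨p, rfl⟩)
    · exact Or.inl h
    · exact Or.inr (.rel _ _)
    · exact Or.inr (.equal _ _)
  have hdef := ppDefinable_of_finite (B := B) hΨ hat
  convert hdef using 1
  ext a
  simp only [approxRel, Set.mem_ofPred_eq]
  constructor
  · rintro ⟨hpos, f, hf, ht⟩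
    refine ⟨f, ?_⟩
    rintro ψ (⟨-, h⟩ | ⟨q, hq, rfl⟩ | ⟨p, rfl⟩)
    · exact absurd h hpos.ne'
    · exact (q.realize_formula _ _).2 (hf q hq)
    · simpa using ht p.1 p.2
  · rintro ⟨f, hf⟩
    refine ⟨Nat.pos_of_ne_zero fun h => hf ⊥ (Or.inl ⟨rfl, h⟩), f, fun q hq => ?_, fun i c => ?_⟩
    · exact (q.realize_formula _ _).1 (hf _ (Or.inr (Or.inl ⟨q, hq, rfl⟩)))
    · simpa using hf _ (Or.inr (Or.inr ⟨(i, c), rfl⟩))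

variable [τ.IsRelational]

/-- The pp-power whose relations are the relations `approxRel`. -/
def approxPower [Nonempty B] {d : ℕ} (hd : 1 ≤ d) (F : Fin d → A₁ → B)
    (Δ : (R : RelSymbol τ) → Set (PreservationInstance L B (Nat.card (RelTuple A₁ R))))
    (hΔ : ∀ R, (Δ R).Finite) : PPPower τ L B where
  dim := d
  one_le_dim := hd
  str :=
    { funMap := fun f => isEmptyElim f
      RelMap := fun {n} R => approxRel F ⟨n, R⟩ (Δ ⟨n, R⟩) }
  ppDefinable n R := ppDefinable_approxRel F ⟨n, R⟩ (hΔ ⟨n, R⟩)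

/-- Evaluation maps `A₁` homomorphically to the approximating pp-power, since projections are
polymorphisms. -/
theorem homTo_approxPower [Nonempty B] {d : ℕ} (hd : 1 ≤ d) (F : Fin d → A₁ → B)
    (Δ : (R : RelSymbol τ) → Set (PreservationInstance L B (Nat.card (RelTuple A₁ R))))
    (hΔ : ∀ R, (Δ R).Finite) : HomTo τ A₁ (approxPower hd F Δ hΔ).Carrier := by
  refine ⟨⟨fun z c => F c z, fun f => isEmptyElim f, fun {n} R t ht => ?_⟩⟩
  obtain ⟨l, hl⟩ := (enumTuples A₁ ⟨n, R⟩).surjective ⟨t, ht⟩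
  refine ⟨l.pos, fun b => b l, fun q _ => q.2 l, fun i c => ?_⟩
  change F c (t i) = F c ((enumTuples A₁ ⟨n, R⟩ l).1 i)
  rw [hl]

/-- If every approximating pp-power that receives a homomorphism from `A₁` receives one from `A₂`,
then every finite part of the requirement that operations on `B` be polymorphisms satisfying
`E(A₁, A₂)` is satisfiable. By compactness, so is the whole requirement. -/
theorem satisfiedIn_pol_of_homTo [Finite τ.Symbols] [Finite A₂] [Nonempty B] [Countable B]
    [Countable L.Symbols] (hB : OmegaCategorical L B)
    (h : ∀ C : PPPower τ L B, HomTo τ A₁ C.Carrier → HomTo τ A₂ C.Carrier) :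
    (minorConditionOf τ A₁ A₂).SatisfiedIn (Pol L B) := by
  classical
  have : Finite (RelSymbol τ) := Finite.of_injective (Sum.inr : _ → τ.Symbols) Sum.inr_injective
  let E := minorConditionOf τ A₁ A₂
  have : Finite E.Symbol := inferInstanceAs (Finite (Σ R : RelSymbol τ, RelTuple A₂ R))
  -- the value of the operation `g` at `b` is denoted by the variable `⟨g, b⟩`
  let Γ : (E.identities × (A₁ → B)) ⊕ (Σ g : E.Symbol, PreservationInstance L B (E.arity g)) →
      L.Formula (Σ g : E.Symbol, (Fin (E.arity g) → B)) :=
    Sum.elim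
      (fun p => Term.equal (Term.var ⟨p.1.1.1.1, fun l => p.2 (p.1.1.1.2 l)⟩)
        (Term.var ⟨p.1.1.2.1, fun l => p.2 (p.1.1.2.2 l)⟩))
      (fun q => q.2.formula (fun b => ⟨q.1, b⟩))
  -- positivity of the arities also comes from the pp-powers: a relation whose counterpart in `A₁`
  -- is empty is defined by `⊥`
  have hfin : ∀ s : Finset _, (∀ g, 0 < E.arity g) ∧ ∃ a : _ → B, ∀ i ∈ s, (Γ i).Realize a := by
    intro s
    -- the constant assignment is added so that the dimension of the pp-power is positive
    let F₀ : Finset (A₁ → B) :=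
      insert (fun _ => Classical.arbitrary B) (s.toLeft.image Prod.snd)
    let F (c : Fin F₀.card) : A₁ → B := (F₀.equivFin.symm c : F₀)
    let Δ (R : RelSymbol τ) : Set (PreservationInstance L B (Nat.card (RelTuple A₁ R))) :=
      {q | ∃ t : RelTuple A₂ R, Sum.inr ⟨⟨R, t⟩, q⟩ ∈ s}
    have hΔ (R : RelSymbol τ) : (Δ R).Finite := by
      have : Δ R = ⋃ t : RelTuple A₂ R,
          (fun q => Sum.inr ⟨⟨R, t⟩, q⟩ : _ → (E.identities × (A₁ → B)) ⊕
            (Σ g : E.Symbol, PreservationInstance L B (E.arity g))) ⁻¹' (s : Set _) := by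
        ext q
        simp only [Δ, Set.mem_iUnion]
        rfl
      rw [this]
      refine Set.finite_iUnion fun t => s.finite_toSet.preimage (Function.Injective.injOn ?_)
      exact Sum.inr_injective.comp sigma_mk_injective
    have hd : 1 ≤ F₀.card := Finset.card_pos.2 ⟨_, Finset.mem_insert_self _ _⟩
    obtain ⟨k⟩ := h (approxPower hd F Δ hΔ) (homTo_approxPower hd F Δ hΔ)
    have hk (g : E.Symbol) : approxRel F g.1 (Δ g.1) fun i => k (g.2.1 i) :=
      k.map_rel g.1.2 g.2.1 g.2.2
    choose hpos f hf hfk using hk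
    refine ⟨hpos, fun p => f p.1 p.2, ?_⟩
    rintro (⟨⟨p, R, S, r, t, i, j, hij, rfl⟩, a⟩ | ⟨⟨R, t⟩, q⟩) hs
    · have ha : a ∈ F₀ := Finset.mem_insert_of_mem
        (Finset.mem_image.2 ⟨_, Finset.mem_toLeft.2 hs, rfl⟩)
      have hc : F (F₀.equivFin ⟨a, ha⟩) = a := by simp [F]
      have h₁ := hfk ⟨R, r⟩ i (F₀.equivFin ⟨a, ha⟩)
      have h₂ := hfk ⟨S, t⟩ j (F₀.equivFin ⟨a, ha⟩)
      rw [hc] at h₁ h₂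
      simp only [Γ, Sum.elim_inl, Formula.realize_equal, Term.realize_var]
      refine h₁.symm.trans (Eq.trans ?_ h₂)
      simp only [hij]
    · exact (q.realize_formula _ _).2 (hf ⟨R, t⟩ q ⟨t, hs⟩)
  obtain ⟨a, ha⟩ := hB.exists_realize Γ fun s => (hfin s).2
  refine ⟨fun g b => a ⟨g, b⟩, fun g => ⟨(hfin ∅).1 g, fun n R t ht => ?_⟩, fun p hp b => ?_⟩
  · exact (PreservationInstance.realize_formula ⟨⟨⟨n, R⟩, t⟩, ht⟩ _ _).1
      (ha (Sum.inr ⟨g, ⟨⟨⟨n, R⟩, t⟩, ht⟩⟩))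
  · simpa [Γ] using ha (Sum.inl ⟨⟨p, hp⟩, b⟩)

end PolymorphismMinion

/-! ### Every finite minor condition is of the form `E(A₁, A₂)` -/

section Encoding

open FirstOrder Language Structure

/-- A presentation of a finite minor condition by finite sets of symbols, of names of variables and
of indices of identities. The `e`-th identity is `side e true ≈ side e false`. The equivalence
`coord` numbers the coordinates of the relations in the structures built from the presentation:
there is one for each side of each identity, and a further one. -/
structure MinorCondition.Presentation (E : MinorCondition.{u, v}) where
  Sym : Type
  Idx : Type
  Name : Type
  finite_sym : Finite Sym
  finite_idx : Finite Idx
  finite_name : Finite Name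
  sym : Sym ≃ E.Symbol
  side : Idx → Bool → Σ f : E.Symbol, (Fin (E.arity f) → E.Var)
  mem_identities : ∀ p, p ∈ E.identities ↔ ∃ e, p = (side e true, side e false)
  name : E.Var → Name
  name_injective : ∀ e b i e' b' i', name ((side e b).2 i) = name ((side e' b').2 i') →
    (side e b).2 i = (side e' b').2 i'
  numCoord : ℕ
  coord : Fin numCoord ≃ Option (Idx × Bool)

theorem MinorCondition.IsFinite.nonempty_presentation {E : MinorCondition.{u, v}}
    (hE : E.IsFinite) : Nonempty E.Presentation := by
  classical
  obtain ⟨hS, hI⟩ := hE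
  have : Finite E.identities := hI
  let idx := (Finite.equivFin E.identities).symm
  let side (e : Fin (Nat.card E.identities)) (b : Bool) :
      Σ f : E.Symbol, (Fin (E.arity f) → E.Var) := bif b then (idx e).1.1 else (idx e).1.2
  let U : Set E.Var :=
    Set.range fun q : Σ p : Fin (Nat.card E.identities) × Bool, Fin (E.arity (side p.1 p.2).1) =>
      (side q.1.1 q.1.2).2 q.2
  have : Finite U := Set.finite_range _
  let name (z : E.Var) : Option (Fin (Nat.card U)) :=
    if hz : z ∈ U then some (Finite.equivFin U ⟨z, hz⟩) else none
  refine ⟨{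
    Sym := Fin (Nat.card E.Symbol)
    Idx := Fin (Nat.card E.identities)
    Name := Option (Fin (Nat.card U))
    finite_sym := inferInstance
    finite_idx := inferInstance
    finite_name := inferInstance
    sym := (Finite.equivFin _).symm
    side := side
    mem_identities := fun p => ⟨fun hp => ⟨idx.symm ⟨p, hp⟩, ?_⟩, ?_⟩
    name := name
    name_injective := fun e b i e' b' i' h => ?_
    numCoord := Nat.card (Option (Fin (Nat.card E.identities) × Bool))
    coord := (Finite.equivFin _).symm }⟩
  · exact congrArg Subtype.val (idx.apply_symm_apply ⟨p, hp⟩).symm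
  · rintro ⟨e, rfl⟩
    exact (idx e).2
  · have h₁ : (side e b).2 i ∈ U := ⟨⟨(e, b), i⟩, rfl⟩
    have h₂ : (side e' b').2 i' ∈ U := ⟨⟨(e', b'), i'⟩, rfl⟩
    simp only [name, dif_pos h₁, dif_pos h₂, Option.some.injEq, EmbeddingLike.apply_eq_iff_eq,
      Subtype.mk.injEq] at h
    exact h

namespace MinorCondition.Presentation

attribute [instance] finite_sym finite_idx finite_name

variable {E : MinorCondition.{u, v}} (P : E.Presentation)

/-- The signature with one relation symbol, of arity `numCoord`, for each function symbol. -/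
def language : FirstOrder.Language.{0, 0} where
  Functions _ := Empty
  Relations n := {_f : P.Sym // n = P.numCoord}

instance : P.language.IsRelational := fun _ => inferInstanceAs (IsEmpty Empty)

instance : Finite P.language.Symbols := by
  let sym : P.language.Symbols → P.Sym := Sum.elim (fun g => isEmptyElim g.2) fun R => R.2.1
  refine Finite.of_injective sym ?_
  rintro (g | ⟨n, f, rfl⟩) (g' | ⟨n', f', rfl⟩) h
  · exact isEmptyElim g.2
  · exact isEmptyElim g.2
  · exact isEmptyElim g'.2
  · cases (show f = f' from h)
    rfl

/-- The domain of the first structure: the names of variables, and the arguments of the symbols. -/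
abbrev Source : Type := P.Name ⊕ Σ f : P.Sym, Fin (E.arity (P.sym f))

/-- The domain of the second structure: the indices of identities, and the symbols. -/
abbrev Target : Type := P.Idx ⊕ P.Sym

open Classical in
/-- The tuple of the relation `f` of the first structure that belongs to the `l`-th argument of
`f`. Its coordinate for a side `f (x₁, …, xₙ)` of an identity is the name of `x_l`; at all other
coordinates it is the argument itself, which makes these tuples distinct. -/
noncomputable def row (f : P.Sym) (l : Fin (E.arity (P.sym f))) : Option (P.Idx × Bool) → P.Source
  | none => Sum.inr ⟨f, l⟩
  | some (e, b) =>
    if h : (P.side e b).1 = P.sym f then Sum.inl (P.name ((P.side e b).2 (h ▸ l)))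
    else Sum.inr ⟨f, l⟩

open Classical in
/-- The only tuple of the relation `f` of the second structure. Its coordinates for the two sides of
an identity agree, provided that `f` is the symbol on this side. -/
noncomputable def target (f : P.Sym) : Option (P.Idx × Bool) → P.Target
  | none => Sum.inr f
  | some (e, b) => if (P.side e b).1 = P.sym f then Sum.inl e else Sum.inr f

noncomputable instance : P.language.Structure P.Source where
  funMap g := isEmptyElim g
  RelMap R t := ∃ l, t = fun i => P.row R.1 l (P.coord (Fin.cast R.2 i))

noncomputable instance : P.language.Structure P.Target where
  funMap g := isEmptyElim g
  RelMap R t := t = fun i => P.target R.1 (P.coord (Fin.cast R.2 i))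

/-- The relation symbol of a function symbol. -/
def rel (f : P.Sym) : RelSymbol P.language := ⟨P.numCoord, ⟨f, rfl⟩⟩

theorem row_injective (f : P.Sym) :
    Function.Injective fun l => (fun i => P.row f l (P.coord i) : Fin P.numCoord → P.Source) := by
  intro l l' h
  have := congrFun h (P.coord.symm none)
  simpa [row] using this

/-- The tuples of the relation `f` of the first structure correspond to the arguments of `f`. -/
noncomputable def argEquiv (f : P.Sym) :
    Fin (E.arity (P.sym f)) ≃ Fin (Nat.card (RelTuple P.Source (P.rel f))) :=
  (Equiv.ofBijective (fun l => ⟨fun i => P.row f l (P.coord i), l, rfl⟩ :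
      Fin (E.arity (P.sym f)) → RelTuple P.Source (P.rel f))
    ⟨fun _ _ h => P.row_injective f (congrArg Subtype.val h),
      fun ⟨_, l, h⟩ => ⟨l, Subtype.ext h.symm⟩⟩).trans (enumTuples P.Source (P.rel f)).symm

theorem enumTuples_argEquiv (f : P.Sym) (l : Fin (E.arity (P.sym f))) (i : Fin P.numCoord) :
    (enumTuples P.Source (P.rel f) (P.argEquiv f l)).1 i = P.row f l (P.coord i) := by
  rw [argEquiv, Equiv.trans_apply, Equiv.apply_symm_apply]
  rfl

/-- The only tuple of the relation `f` of the second structure, as an element of the relation. -/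
noncomputable def tgt (f : P.Sym) : RelTuple P.Target (P.rel f) :=
  ⟨fun i => P.target f (P.coord i), rfl⟩

variable {X : Type w} {Y : Type x}

theorem apply_side {f : P.Sym} {e : P.Idx} {b : Bool} (h : (P.side e b).1 = P.sym f)
    (I : (f : E.Symbol) → (Fin (E.arity f) → X) → Y) (a : E.Var → X) :
    I (P.side e b).1 (fun i => a ((P.side e b).2 i)) =
      I (P.sym f) fun l => a ((P.side e b).2 (h ▸ l)) := by
  generalize P.side e b = s at h
  obtain ⟨g, t⟩ := s
  cases h
  rfl

theorem apply_row_of_target_eq_inl {f : P.Sym} {o : Option (P.Idx × Bool)} {e : P.Idx}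
    (h : P.target f o = Sum.inl e) (I : (f : E.Symbol) → (Fin (E.arity f) → X) → Y)
    (a : P.Source → X) :
    ∃ b, I (P.sym f) (fun l => a (P.row f l o)) =
      I (P.side e b).1 fun i => a (Sum.inl (P.name ((P.side e b).2 i))) := by
  rcases o with _ | ⟨e', b⟩
  · simp [target] at h
  · by_cases hs : (P.side e' b).1 = P.sym f
    · obtain rfl : e' = e := by simpa [target, hs] using h
      refine ⟨b, ?_⟩
      rw [P.apply_side hs I fun z => a (Sum.inl (P.name z))]
      simp [row, hs]
    · simp [target, hs] at h

theorem row_of_target_eq_inr {f g : P.Sym} {o : Option (P.Idx × Bool)}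
    (h : P.target f o = Sum.inr g) : g = f ∧ ∀ l, P.row f l o = Sum.inr ⟨f, l⟩ := by
  rcases o with _ | ⟨e, b⟩
  · exact ⟨by simpa [target, eq_comm] using h, fun l => rfl⟩
  · by_cases hs : (P.side e b).1 = P.sym f
    · simp [target, hs] at h
    · exact ⟨by simpa [target, hs, eq_comm] using h, fun l => by simp [row, hs]⟩

/-- Coordinates at which the tuples of the second structure agree belong to the two sides of an
identity of `E`, or to the same term. -/
theorem apply_row_eq {I : (f : E.Symbol) → (Fin (E.arity f) → X) → Y}
    (hI : ∀ p ∈ E.identities, ∀ a : E.Var → X,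
      I p.1.1 (fun i => a (p.1.2 i)) = I p.2.1 (fun i => a (p.2.2 i)))
    {f g : P.Sym} {o o' : Option (P.Idx × Bool)} (h : P.target f o = P.target g o')
    (a : P.Source → X) :
    I (P.sym f) (fun l => a (P.row f l o)) = I (P.sym g) fun l => a (P.row g l o') := by
  cases hf : P.target f o with
  | inl e =>
    have hid : I (P.side e true).1 (fun i => a (Sum.inl (P.name ((P.side e true).2 i)))) =
        I (P.side e false).1 fun i => a (Sum.inl (P.name ((P.side e false).2 i))) :=
      hI _ ((P.mem_identities _).2 ⟨e, rfl⟩) fun z => a (Sum.inl (P.name z))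
    obtain ⟨b, hb⟩ := P.apply_row_of_target_eq_inl hf I a
    obtain ⟨b', hb'⟩ := P.apply_row_of_target_eq_inl (h.symm.trans hf) I a
    rw [hb, hb']
    cases b <;> cases b' <;> first | rfl | exact hid | exact hid.symm
  | inr k =>
    obtain ⟨rfl, h₁⟩ := P.row_of_target_eq_inr hf
    obtain ⟨rfl, h₂⟩ := P.row_of_target_eq_inr (h.symm.trans hf)
    simp only [h₁, h₂]

theorem satisfiedIn_minorConditionOf {M : Minion X Y} (h : E.SatisfiedIn M) :
    (minorConditionOf P.language P.Source P.Target).SatisfiedIn M := by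
  obtain ⟨I, hmem, hid⟩ := h
  have hrel (R : RelSymbol P.language) : P.rel R.2.1 = R := by
    obtain ⟨_, f, rfl⟩ := R
    rfl
  let σ (R : RelSymbol P.language) :
      Fin (E.arity (P.sym R.2.1)) → Fin (Nat.card (RelTuple P.Source R)) :=
    hrel R ▸ P.argEquiv R.2.1
  have hσ (R : RelSymbol P.language) (l) (i : Fin R.1) :
      (enumTuples P.Source R (σ R l)).1 i = P.row R.2.1 l (P.coord (Fin.cast R.2.2 i)) := by
    obtain ⟨_, f, rfl⟩ := R
    exact P.enumTuples_argEquiv f l i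
  refine ⟨fun g a => I (P.sym g.1.2.1) fun l => a (σ g.1 l),
    fun g => M.minor_mem (hmem _) _, ?_⟩
  rintro _ ⟨R, S, r, s, i, j, hij, rfl⟩ a
  simp only [hσ]
  refine P.apply_row_eq hid ?_ a
  have hr : r.1 = _ := r.2
  have hs : s.1 = _ := s.2
  rw [hr, hs] at hij
  exact hij

theorem satisfiedIn_of_minorConditionOf {M : Minion X Y}
    (h : (minorConditionOf P.language P.Source P.Target).SatisfiedIn M) : E.SatisfiedIn M := by
  classical
  obtain ⟨I', hmem, hid⟩ := h
  let J (f : P.Sym) (a : Fin (E.arity (P.sym f)) → X) : Y :=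
    I' ⟨P.rel f, P.tgt f⟩ fun l => a ((P.argEquiv f).symm l)
  let I : (f : E.Symbol) → (Fin (E.arity f) → X) → Y :=
    Equiv.piCongrLeft (fun f => (Fin (E.arity f) → X) → Y) P.sym J
  have hIJ (f : P.Sym) : I (P.sym f) = J f := Equiv.piCongrLeft_apply_apply _ _ _ _
  have hI (f : E.Symbol) : I f ∈ M.ops (E.arity f) := by
    obtain ⟨f, rfl⟩ := P.sym.surjective f
    rw [hIJ]
    exact M.minor_mem (hmem ⟨P.rel f, P.tgt f⟩) _
  refine ⟨I, hI, fun p hp a => ?_⟩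
  obtain ⟨e, rfl⟩ := (P.mem_identities p).1 hp
  -- arities are positive, so an assignment of variables to `X` provides an element of `X`
  let x₀ : X := a ((P.side e true).2 ⟨0, M.arity_pos (hI _)⟩)
  let value (z : P.Name) : X :=
    if hz : ∃ q : Σ p : P.Idx × Bool, Fin (E.arity (P.side p.1 p.2).1),
        P.name ((P.side q.1.1 q.1.2).2 q.2) = z then
      a ((P.side hz.choose.1.1 hz.choose.1.2).2 hz.choose.2)
    else x₀
  have hvalue (e : P.Idx) (b : Bool) (i) :
      value (P.name ((P.side e b).2 i)) = a ((P.side e b).2 i) := by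
    have hz : ∃ q : Σ p : P.Idx × Bool, Fin (E.arity (P.side p.1 p.2).1),
        P.name ((P.side q.1.1 q.1.2).2 q.2) = P.name ((P.side e b).2 i) := ⟨⟨(e, b), i⟩, rfl⟩
    exact (dif_pos hz).trans (congrArg a (P.name_injective _ _ _ _ _ _ hz.choose_spec))
  let a' : P.Source → X := Sum.elim value fun _ => x₀
  have key (b : Bool) (f : P.Sym) (hf : (P.side e b).1 = P.sym f) :
      I (P.side e b).1 (fun i => a ((P.side e b).2 i)) = I' ⟨P.rel f, P.tgt f⟩
        fun l => a' ((enumTuples P.Source (P.rel f) l).1 (P.coord.symm (some (e, b)))) := by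
    rw [P.apply_side hf I a, hIJ]
    refine congrArg (I' ⟨P.rel f, P.tgt f⟩) (funext fun l => ?_)
    obtain ⟨l, rfl⟩ := (P.argEquiv f).surjective l
    rw [P.enumTuples_argEquiv]
    simp [row, hf, a', hvalue]
  have hsym (b : Bool) : (P.side e b).1 = P.sym (P.sym.symm (P.side e b).1) := by simp
  refine (key true _ (hsym true)).trans (Eq.trans ?_ (key false _ (hsym false)).symm)
  refine hid _ ⟨_, _, P.tgt _, P.tgt _, _, _, ?_, rfl⟩ a'
  simp [tgt, target]

end MinorCondition.Presentation

end Encoding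

/-! ### Satisfaction of minor conditions and pp-powers -/

theorem mainTheorem6 (E : MinorCondition.{x, y}) (hE : E.IsFinite) :
    (∃ (τ : FirstOrder.Language.{0, 0}) (_ : τ.IsRelational) (_ : Finite τ.Symbols)
        (A₁ A₂ : Type) (_ : τ.Structure A₁) (_ : τ.Structure A₂) (_ : Finite A₁) (_ : Finite A₂),
        MinorCondition.Equivalent.{x, y, w} E (minorConditionOf τ A₁ A₂)) ∧
    ∀ (τ : FirstOrder.Language.{u₁, v₁}) [τ.IsRelational] [Finite τ.Symbols]
      (A₁ : Type w₁) (A₂ : Type w₂) [τ.Structure A₁] [τ.Structure A₂] [Finite A₁] [Finite A₂],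
      MinorCondition.Equivalent.{x, y, w} E (minorConditionOf τ A₁ A₂) →
      ∀ (L : FirstOrder.Language.{u, v}) [L.IsRelational] [Countable L.Symbols]
        (B : Type w) [L.Structure B] [Nonempty B] [Countable B], OmegaCategorical L B →
        (E.SatisfiedIn (Pol L B) ↔
          ∀ C : PPPower τ L B, HomTo τ A₁ C.Carrier → HomTo τ A₂ C.Carrier) := by
  refine ⟨?_, fun τ _ _ A₁ A₂ _ _ _ _ heq L _ _ B _ _ _ hB => (heq B B (Pol L B)).trans
    ⟨homTo_of_satisfiedIn_pol, satisfiedIn_pol_of_homTo hB⟩⟩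
  obtain ⟨P⟩ := hE.nonempty_presentation
  exact ⟨P.language, inferInstance, inferInstance, P.Source, P.Target, inferInstance, inferInstance,
    inferInstance, inferInstance, fun _ _ _ =>
      ⟨P.satisfiedIn_minorConditionOf, P.satisfiedIn_of_minorConditionOf⟩⟩
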